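/- All rings are commutative and unital. A difference ring is a ring with a ring endomorphism $\sigma$ (not assumed bijective). Let $(k,\sigma)$ be a difference field. A difference $k$-algebra is a $k$-algebra $A$ with a ring endomorphism $\sigma_A$ such that $\sigma_A(\lambda\cdot 1)=\sigma(\lambda)\cdot 1$ for all $\lambda\in k$. Étale $k$-algebra means étale of finite presentation, i.e. a finite product of finite separable field extensions of $k$. A cocorrespondence of étale $k$-algebras consists of étale $k$-algebras $A_0,C_0$, a $k$-algebra homomorphism $p\colon A_0\to C_0$ and a ring homomorphism $s\colon A_0\to C_0$ with $s(\lambda\cdot 1)=\sigma(\lambda)\cdot 1$ for all $\lambda\in k$. Let $[A_0;C_0]_\sigma^k$ be the universal difference $k$-algebra $B$ equipped with a $k$-algebra homomorphism $f\colon C_0\to B$ such that $f\circ s=\sigma_B\circ f\circ p$. A difference $k$-algebra is finitely $\sigma$-presented étale if it is isomorphic, as a difference $k$-algebra, to $[A_0;C_0]_\sigma^k$ for some cocorrespondence of étale $k$-algebras. A difference $k$-algebra $A$ is strongly $\sigma$-étale if $A$ is an étale $k$-algebra and the map $A\otimes_{k,\sigma}k\to A$, $a\otimes\lambda\mapsto\sigma_A(a)\lambda$,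 is injective. The strong core $\pi_0^\sigma(A)$ is the union of all $\sigma_A$-stable $k$-subalgebras of $A$ which, with the induced endomorphism, are strongly $\sigma$-étale. **Proposition.** If $A$ is a finitely $\sigma$-presented étale difference algebra over a difference field $k$, then $\pi_0^\sigma(A)$ is a $\sigma_A$-stable $k$-subalgebra of $A$ and is itself a strongly $\sigma$-étale $k$-algebra. -/

import Mathlib

open scoped TensorProduct

universe u v w

/-! Difference algebra. A difference ring is a commutative ring with a ring endomorphism `σ`
(not assumed bijective); a difference field is a difference ring that is a field. -/

namespace DiffAlg

/-- `(A, σA)` is a difference algebra over `(k, σ)`: `A` is a `k`-algebra and the structure map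
`k → A` commutes with the endomorphisms. -/
def IsDiffAlgebra {k : Type u} [CommRing k] (σ : k →+* k)
    {A : Type v} [CommRing A] [Algebra k A] (σA : A →+* A) : Prop :=
  ∀ c : k, σA (algebraMap k A c) = algebraMap k A (σ c)

section Presentation

variable {k : Type u} [CommRing k] (σ : k →+* k)

/-- A cocorrespondence `A₀ → C₀ ← A₀` over the difference ring `(k, σ)`: the left leg `p` lies over
`id : k → k` and the right leg `s` lies over `σ : k → k`. -/
structure Cocorrespondence (A₀ C₀ : Type w) [CommRing A₀] [Algebra k A₀]
    [CommRing C₀] [Algebra k C₀] where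
  p : A₀ →ₐ[k] C₀
  s : A₀ →+* C₀
  s_algebraMap : ∀ c : k, s (algebraMap k A₀ c) = algebraMap k C₀ (σ c)

variable {σ} {A₀ C₀ : Type w} [CommRing A₀] [Algebra k A₀] [CommRing C₀] [Algebra k C₀]

open MvPolynomial

namespace Cocorrespondence

/-- The variable `X (n, c)` stands for the element `σⁿ(c)` of the algebra to be constructed. The
first three families of relations say that `c ↦ X (n, c)` is a ring homomorphism over
`σⁿ : k → k`; the last says that `σ(p a) = s a` for `a` in `A₀`, after applying `σⁿ`. -/
inductive Rel (D : Cocorrespondence σ A₀ C₀) : MvPolynomial (ℕ × C₀) k → Prop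
  | add (n : ℕ) (c d : C₀) : Rel D (X (n, c + d) - (X (n, c) + X (n, d)))
  | mul (n : ℕ) (c d : C₀) : Rel D (X (n, c * d) - X (n, c) * X (n, d))
  | scalar (n : ℕ) (r : k) : Rel D (X (n, algebraMap k C₀ r) - C ((σ^[n]) r))
  | glue (n : ℕ) (a : A₀) : Rel D (X (n, D.s a) - X (n + 1, D.p a))

/-- The ideal of relations. -/
noncomputable def relIdeal (D : Cocorrespondence σ A₀ C₀) : Ideal (MvPolynomial (ℕ × C₀) k) :=
  Ideal.span {f | D.Rel f}

/-- The endomorphism of the polynomial ring that extends `σ : k → k` and sends the variable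
`(n, c)` to `(n + 1, c)`. -/
noncomputable def shift (σ : k →+* k) (C₀ : Type w) :
    MvPolynomial (ℕ × C₀) k →+* MvPolynomial (ℕ × C₀) k :=
  eval₂Hom (C.comp σ) (fun x => X (x.1 + 1, x.2))

theorem relIdeal_le_comap (D : Cocorrespondence σ A₀ C₀) :
    D.relIdeal ≤ D.relIdeal.comap (shift σ C₀) := by
  refine Ideal.span_le.2 ?_
  rintro f (⟨n, c, d⟩ | ⟨n, c, d⟩ | ⟨n, r⟩ | ⟨n, a⟩) <;> refine Ideal.subset_span ?_
  · simpa [shift] using Rel.add (D := D) (n + 1) c d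
  · simpa [shift] using Rel.mul (D := D) (n + 1) c d
  · simpa [shift, Function.iterate_succ_apply'] using Rel.scalar (D := D) (n + 1) r
  · simpa [shift] using Rel.glue (D := D) (n + 1) a

/-- The underlying `k`-algebra of the difference `k`-algebra directly presented by the
cocorrespondence `A₀ → C₀ ← A₀`, that is, of the universal difference `k`-algebra `B` with a
`k`-algebra homomorphism `f : C₀ → B` such that `f ∘ s = σ_B ∘ f ∘ p`. -/
abbrev Presented (D : Cocorrespondence σ A₀ C₀) : Type (max u w) :=
  MvPolynomial (ℕ × C₀) k ⧸ D.relIdeal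

/-- The endomorphism of the directly presented difference `k`-algebra. -/
noncomputable def presentedσ (D : Cocorrespondence σ A₀ C₀) : D.Presented →+* D.Presented :=
  Ideal.quotientMap D.relIdeal (shift σ C₀) D.relIdeal_le_comap

end Cocorrespondence

end Presentation

/-- `(A, σA)` is a finitely σ-presented étale difference `(k, σ)`-algebra: it is isomorphic, as a
difference `k`-algebra, to the one directly presented by a cocorrespondence of étale
`k`-algebras. -/
def IsFinPresEtale {k : Type u} [CommRing k] (σ : k →+* k)
    {A : Type v} [CommRing A] [Algebra k A] (σA : A →+* A) : Prop :=
  ∃ (A₀ C₀ : Type w) (_ : CommRing A₀) (_ : Algebra k A₀) (_ : CommRing C₀) (_ : Algebra k C₀)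
    (D : Cocorrespondence σ A₀ C₀),
    Algebra.Etale k A₀ ∧ Algebra.Etale k C₀ ∧
      ∃ e : A ≃ₐ[k] D.Presented, ∀ a : A, e (σA a) = D.presentedσ (e a)

/-- The ring `k`, regarded as a `k`-algebra through `σ : k → k`. -/
def Twist {k : Type u} [CommRing k] (_σ : k →+* k) : Type u := k

namespace Twist

variable {k : Type u} [CommRing k] (σ : k →+* k)

instance : CommRing (Twist σ) := inferInstanceAs (CommRing k)

instance : Algebra k (Twist σ) := RingHom.toAlgebra (S := Twist σ) σ

/-- The identity map from the twisted copy of `k` to `k`. -/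
def toBase : Twist σ →+* k := RingHom.id k

theorem toBase_smul (r : k) (x : Twist σ) : toBase σ (r • x) = σ r * toBase σ x := rfl

end Twist

section Strong

variable {k : Type u} [CommRing k] (σ : k →+* k)
  {A : Type v} [CommRing A] [Algebra k A] (σA : A →+* A)

/-- The additive map `A ⊗ₖ k → A`, `a ⊗ c ↦ σ(a) c`, where `k` is a `k`-algebra through `σ`. -/
noncomputable def twistMap (hA : IsDiffAlgebra σ σA) : A ⊗[k] Twist σ →+ A :=
  TensorProduct.liftAddHom
    ((AddMonoidHom.mul.comp σA.toAddMonoidHom).compl₂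
      ((algebraMap k A).comp (Twist.toBase σ)).toAddMonoidHom)
    (fun r a x => by
      have h : Twist.toBase σ (r • x) = σ r * Twist.toBase σ x := Twist.toBase_smul σ r x
      change σA (r • a) * algebraMap k A (Twist.toBase σ x) =
        σA a * algebraMap k A (Twist.toBase σ (r • x))
      rw [h, Algebra.smul_def, map_mul, map_mul, hA r]
      ring)

theorem twistMap_tmul (hA : IsDiffAlgebra σ σA) (a : A) (x : Twist σ) :
    twistMap σ σA hA (a ⊗ₜ x) = σA a * algebraMap k A (Twist.toBase σ x) := rfl

/-- The difference `k`-algebra `(A, σA)` is σ-separable: `a ⊗ c ↦ σ(a) c` is injective. -/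
def IsSigmaSeparable (hA : IsDiffAlgebra σ σA) : Prop :=
  Function.Injective (twistMap σ σA hA)

/-- The difference `k`-algebra `(A, σA)` is strongly σ-étale. -/
def IsStronglyEtale (hA : IsDiffAlgebra σ σA) : Prop :=
  IsSigmaSeparable σ σA hA ∧ Algebra.Etale k A

/-- The endomorphism that `σA` induces on a σ-stable `k`-subalgebra. -/
def subσ (B : Subalgebra k A) (hB : ∀ b ∈ B, σA b ∈ B) : B →+* B :=
  σA.restrict B B hB

variable {σ σA}

theorem IsDiffAlgebra.subalgebra (hA : IsDiffAlgebra σ σA) (B : Subalgebra k A)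
    (hB : ∀ b ∈ B, σA b ∈ B) : IsDiffAlgebra σ (subσ σA B hB) :=
  fun c => Subtype.ext (hA c)

/-- The `k`-subalgebra `B` of the difference `k`-algebra `(A, σA)` is a difference subalgebra
(it is σ-stable) and is strongly σ-étale with the induced endomorphism. -/
def IsStronglyEtaleSubalgebra (hA : IsDiffAlgebra σ σA) (B : Subalgebra k A) : Prop :=
  ∃ hB : ∀ b ∈ B, σA b ∈ B, IsStronglyEtale σ (subσ σA B hB) (hA.subalgebra B hB)

/-- The strong core of the difference `k`-algebra `(A, σA)`: the union, as a set, of all its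
strongly σ-étale `k`-subalgebras. -/
def strongCore (hA : IsDiffAlgebra σ σA) : Set A :=
  ⋃ B ∈ {B : Subalgebra k A | IsStronglyEtaleSubalgebra hA B}, (B : Set A)

end Strong

end DiffAlg

/-! Strongly σ-étale subalgebras include `k` and are closed under compositum, so it suffices to
bound their dimensions: one of maximal dimension then contains every other and equals the strong
core.

For the bound, let `f n : C₀ → A` be the copy of `C₀` at time `n`. A strongly σ-étale `B` is
finite-dimensional, hence lies in the algebra generated by times up to some `m`. It is also spanned
by `σ(B)`, hence by `σᵐ(B)`, and so lies in the algebra generated by times from `m` on. The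
relations link only neighbouring times, so past and future are independent over the present, the
subalgebra `D` generated by `f m`; their intersection is `D` (`timeAdjoin_inf_le`). Thus `B ≤ D`,
and `dim D ≤ dim C₀` whatever `m` is. -/

namespace DiffAlg

/-! ### Unramified subalgebras and descent along a semisimple subalgebra. -/

section Unramified

theorem formallyUnramified_range {k A E : Type*} [CommRing k] [CommRing A] [Algebra k A]
    [CommRing E] [Algebra k E] [Algebra.FormallyUnramified k E] (g : E →ₐ[k] A) :
    Algebra.FormallyUnramified k g.range :=
  .of_surjective g.rangeRestrict g.rangeRestrict_surjective

theorem formallyUnramified_sup {k A : Type*} [CommRing k] [CommRing A] [Algebra k A]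
    (B₁ B₂ : Subalgebra k A) [Algebra.FormallyUnramified k B₁] [Algebra.FormallyUnramified k B₂] :
    Algebra.FormallyUnramified k (B₁ ⊔ B₂ : Subalgebra k A) := by
  have : Algebra.FormallyUnramified k (B₁ ⊗[k] B₂) := .comp k B₁ (B₁ ⊗[k] B₂)
  have h := formallyUnramified_range (Algebra.TensorProduct.productMap B₁.val B₂.val)
  rwa [Algebra.TensorProduct.productMap_range, Subalgebra.range_val, Subalgebra.range_val] at h

theorem formallyUnramified_bot {k A : Type*} [CommRing k] [CommRing A] [Algebra k A] :
    Algebra.FormallyUnramified k (⊥ : Subalgebra k A) := by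
  rw [← Algebra.range_ofId]
  exact formallyUnramified_range _

/-- The subalgebra generated by the image of an unramified algebra under a homomorphism that is
semilinear with respect to a map of base rings is unramified. -/
theorem formallyUnramified_adjoin_range {K K' C A : Type*} [CommRing K] [CommRing K']
    [CommRing C] [Algebra K C] [Algebra.FormallyUnramified K C] [CommRing A] [Algebra K' A]
    (τ : K →+* K') (f : C →+* A)
    (hf : ∀ r, f (algebraMap K C r) = algebraMap K' A (τ r)) :
    Algebra.FormallyUnramified K' (Algebra.adjoin K' (Set.range f)) := by
  let _ : Algebra K K' := τ.toAlgebra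
  let _ : Algebra K A := ((algebraMap K' A).comp τ).toAlgebra
  have : IsScalarTower K K' A := .of_algebraMap_eq fun _ => rfl
  let f' : C →ₐ[K] A := { f with commutes' := hf }
  -- Unramifiedness survives base change along `τ` and passes to the image of `g`.
  let g : K' ⊗[K] C →ₐ[K'] A :=
    Algebra.TensorProduct.lift (Algebra.ofId K' A) f' fun _ _ => .all _ _
  have hg : g.range = Algebra.adjoin K' (Set.range f) := by
    refine le_antisymm ?_ (Algebra.adjoin_le ?_)
    · rintro _ ⟨x, rfl⟩
      induction x using TensorProduct.induction_on with
      | zero => exact (map_zero g) ▸ zero_mem _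
      | tmul a c =>
        change algebraMap K' A a * f c ∈ _
        exact mul_mem (Subalgebra.algebraMap_mem _ a) (Algebra.subset_adjoin ⟨c, rfl⟩)
      | add x y hx hy => exact (map_add g x y) ▸ add_mem hx hy
    · rintro _ ⟨c, rfl⟩
      exact ⟨1 ⊗ₜ c, show algebraMap K' A 1 * f c = f c by simp⟩
  exact hg ▸ formallyUnramified_range g

/-- Over a field, étale algebras are the formally unramified ones of finite dimension. -/
theorem etale_of_formallyUnramified {k B : Type*} [Field k] [CommRing B] [Algebra k B]
    [Module.Finite k B] [Algebra.FormallyUnramified k B] : Algebra.Etale k B where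
  formallyEtale := Algebra.FormallyEtale.of_formallyUnramified_of_field k B
  finitePresentation := Algebra.FinitePresentation.of_finiteType.mp inferInstance

theorem finite_of_etale {k B : Type*} [Field k] [CommRing B] [Algebra k B]
    [Algebra.Etale k B] : Module.Finite k B :=
  Algebra.FormallyUnramified.finite_of_free k B

/-- If `D` is a semisimple subalgebra of `A`, then `D` is the equalizer of the two maps
`A → A ⊗[D] A`. -/
theorem mem_of_tmul_one_eq_one_tmul {k A : Type*} [CommRing k] [CommRing A] [Algebra k A]
    (D : Subalgebra k A) [IsSemisimpleRing D] {x : A}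
    (hx : x ⊗ₜ[D] (1 : A) = (1 : A) ⊗ₜ[D] x) : x ∈ D := by
  -- Semisimplicity yields a `D`-linear retraction `ρ` of `A` onto the image of `D`; applying `a ⊗ b
  -- ↦ ρ(a) b` to `hx` gives `ρ x = x`.
  obtain ⟨q, hq⟩ := exists_isCompl (LinearMap.range (Algebra.linearMap D A))
  let π := (LinearMap.range (Algebra.linearMap D A)).projectionOnto q hq
  let ρ : A →ₗ[D] A := (Submodule.subtype _).comp π
  have h1 : ρ 1 = 1 := by
    have := Submodule.projectionOnto_apply_left hq ⟨1, 1, by simp⟩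
    exact congrArg Subtype.val this
  have h := congrArg (LinearMap.mul' D A ∘ₗ ρ.rTensor A) hx
  have h' : ρ x * 1 = ρ 1 * x := h
  rw [h1, one_mul, mul_one] at h'
  obtain ⟨d, hd⟩ := (π x).2
  have : (d : A) = x := hd.trans h'
  exact this ▸ d.2

end Unramified

/-! ### Strongly σ-étale subalgebras and their composita. -/

section Strong

variable {k : Type u} [Field k] {σ : k →+* k} {A : Type v} [CommRing A] [Algebra k A]
  {σA : A →+* A}

/-- In the coordinates that `b` gives on the tensor product, `twistMap` is the linear combination
map of the family `σA (b i)`. -/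
theorem isSigmaSeparable_iff_linearIndependent (hA : IsDiffAlgebra σ σA) {ι : Type*}
    (b : Module.Basis ι k A) :
    IsSigmaSeparable σ σA hA ↔ LinearIndependent k (fun i => σA (b i)) := by
  classical
  have key : ∀ l : ι →₀ Twist σ,
      twistMap σ σA hA ((TensorProduct.equivFinsuppOfBasisLeft b).symm l) =
        Finsupp.linearCombination k (fun i => σA (b i)) (show ι →₀ k from l) := by
    intro l
    rw [TensorProduct.equivFinsuppOfBasisLeft_symm_apply, Finsupp.linearCombination_apply]
    unfold Finsupp.sum
    rw [map_sum]
    refine Finset.sum_congr rfl fun i _ => ?_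
    rw [twistMap_tmul]
    exact (mul_comm _ _).trans (Algebra.smul_def (R := k) (Twist.toBase σ (l i)) (σA (b i))).symm
  have h : (Finsupp.linearCombination k (fun i => σA (b i)) : (ι →₀ k) → A) =
      twistMap σ σA hA ∘ (TensorProduct.equivFinsuppOfBasisLeft (N := Twist σ) b).symm :=
    funext fun l => (key l).symm
  unfold IsSigmaSeparable LinearIndependent
  rw [h]
  exact (Equiv.injective_comp (TensorProduct.equivFinsuppOfBasisLeft b).symm.toEquiv _).symm

theorem span_range_basis (hA : IsDiffAlgebra σ σA) {ι : Type*} (b : Module.Basis ι k A) :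
    Submodule.span k (Set.range fun i => σA (b i)) = Submodule.span k (Set.range σA) := by
  refine le_antisymm (Submodule.span_mono ?_) (Submodule.span_le.2 ?_)
  · rintro _ ⟨i, rfl⟩
    exact ⟨b i, rfl⟩
  · rintro _ ⟨a, rfl⟩
    rw [← b.linearCombination_repr a, Finsupp.linearCombination_apply, Finsupp.sum, map_sum]
    refine sum_mem fun i _ => ?_
    rw [Algebra.smul_def, map_mul, hA, ← Algebra.smul_def]
    exact Submodule.smul_mem _ _ (Submodule.subset_span ⟨i, rfl⟩)

/-- A finite-dimensional difference algebra over a difference field is σ-separable if and only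
if it is spanned by the image of its endomorphism. -/
theorem isSigmaSeparable_iff_span (hA : IsDiffAlgebra σ σA) [Module.Finite k A] :
    IsSigmaSeparable σ σA hA ↔ Submodule.span k (Set.range σA) = ⊤ := by
  let b := Module.finBasis k A
  rw [isSigmaSeparable_iff_linearIndependent hA b, ← span_range_basis hA b]
  -- The family has exactly `dim A` members, so independence and spanning coincide.
  constructor
  · intro h
    exact h.span_eq_top_of_card_eq_finrank' (by simp)
  · intro h
    exact linearIndependent_of_top_le_span_of_card_eq_finrank h.ge (by simp)

/-- The difference subalgebra `B` is strongly σ-étale if and only if it is finite-dimensional,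
unramified, and spanned by `σ(B)`. -/
theorem isStronglyEtaleSubalgebra_iff (hA : IsDiffAlgebra σ σA) (B : Subalgebra k A) :
    IsStronglyEtaleSubalgebra hA B ↔ Module.Finite k B ∧ Algebra.FormallyUnramified k B ∧
      Submodule.span k (σA '' B) = Subalgebra.toSubmodule B := by
  have key : ∀ hB : ∀ b ∈ B, σA b ∈ B,
      Submodule.span k (Set.range (subσ σA B hB)) = ⊤ ↔
        Submodule.span k (σA '' B) = Subalgebra.toSubmodule B := by
    intro hB
    have h1 : (Submodule.span k (Set.range (subσ σA B hB))).map
        (Subalgebra.toSubmodule B).subtype = Submodule.span k (σA '' B) := by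
      rw [Submodule.map_span, ← Set.range_comp]
      congr 1
      ext x
      constructor
      · rintro ⟨b, rfl⟩
        exact ⟨b, b.2, rfl⟩
      · rintro ⟨b, hb, rfl⟩
        exact ⟨⟨b, hb⟩, rfl⟩
    rw [← h1]
    constructor
    · intro h
      rw [h, Submodule.map_top, Submodule.range_subtype]
    · intro h
      refine Submodule.map_injective_of_injective (Subalgebra.toSubmodule B).injective_subtype ?_
      rw [Submodule.map_top, Submodule.range_subtype]
      exact h
  constructor
  · rintro ⟨hB, hs, he⟩
    have hfin : Module.Finite k B := finite_of_etale
    exact ⟨hfin, inferInstance, (key hB).1 ((isSigmaSeparable_iff_span _).1 hs)⟩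
  · rintro ⟨hfin, hu, hs⟩
    -- σ-stability is already contained in the span equality.
    have hB : ∀ b ∈ B, σA b ∈ B := fun b hb =>
      show σA b ∈ Subalgebra.toSubmodule B from hs ▸ Submodule.subset_span ⟨b, hb, rfl⟩
    exact ⟨hB, (isSigmaSeparable_iff_span _).2 ((key hB).2 hs), etale_of_formallyUnramified⟩

theorem isStronglyEtaleSubalgebra_bot (hA : IsDiffAlgebra σ σA) :
    IsStronglyEtaleSubalgebra hA ⊥ := by
  refine (isStronglyEtaleSubalgebra_iff hA _).2 ⟨inferInstance, formallyUnramified_bot, ?_⟩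
  refine le_antisymm (Submodule.span_le.2 ?_) ?_
  · rintro _ ⟨_, ⟨c, rfl⟩, rfl⟩
    exact ⟨σ c, (hA c).symm⟩
  · rintro _ ⟨c, rfl⟩
    change algebraMap k A c ∈ _
    rw [Algebra.algebraMap_eq_smul_one]
    exact Submodule.smul_mem _ _ (Submodule.subset_span ⟨1, one_mem _, map_one σA⟩)

/-- As a module the compositum is the product `B₁ B₂`, and the span of `σ(B₁)` times the span of
`σ(B₂)` is spanned by the elements `σ(xy)`. -/
theorem IsStronglyEtaleSubalgebra.sup {hA : IsDiffAlgebra σ σA} {B₁ B₂ : Subalgebra k A}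
    (h₁ : IsStronglyEtaleSubalgebra hA B₁) (h₂ : IsStronglyEtaleSubalgebra hA B₂) :
    IsStronglyEtaleSubalgebra hA (B₁ ⊔ B₂) := by
  obtain ⟨hf₁, hu₁, hs₁⟩ := (isStronglyEtaleSubalgebra_iff hA _).1 h₁
  obtain ⟨hf₂, hu₂, hs₂⟩ := (isStronglyEtaleSubalgebra_iff hA _).1 h₂
  refine (isStronglyEtaleSubalgebra_iff hA _).2
    ⟨Subalgebra.finite_sup _ _, formallyUnramified_sup _ _, ?_⟩
  obtain ⟨hB₁, -⟩ := h₁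
  obtain ⟨hB₂, -⟩ := h₂
  refine le_antisymm (Submodule.span_le.2 ?_) ?_
  · rintro _ ⟨b, hb, rfl⟩
    have hb' : b ∈ Subalgebra.toSubmodule B₁ * Subalgebra.toSubmodule B₂ := by
      rw [Subalgebra.mul_toSubmodule]
      exact hb
    refine Submodule.mul_induction_on hb' (fun x hx y hy => ?_) fun x y hx hy => ?_
    · rw [map_mul]
      exact (B₁ ⊔ B₂).mul_mem (le_sup_left (a := B₁) (hB₁ x hx)) (le_sup_right (a := B₁) (hB₂ y hy))
    · rw [map_add]
      exact add_mem hx hy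
  · rw [← Subalgebra.mul_toSubmodule, ← hs₁, ← hs₂, Submodule.span_mul_span]
    refine Submodule.span_mono ?_
    rintro _ ⟨_, ⟨x, hx, rfl⟩, _, ⟨y, hy, rfl⟩, rfl⟩
    exact ⟨x * y, mul_mem (le_sup_left (a := B₁) hx) (le_sup_right (a := B₁) hy), map_mul _ _ _⟩

end Strong

/-! ### The presented algebra as a chain of copies of `C₀`. -/

section Presented

open MvPolynomial

variable {k : Type u} [CommRing k] {σ : k →+* k} {A₀ C₀ : Type w} [CommRing A₀] [Algebra k A₀]
  [CommRing C₀] [Algebra k C₀]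

namespace Cocorrespondence

variable (D : Cocorrespondence σ A₀ C₀)

/-- The class of the variable `X (n, c)`. -/
noncomputable def var (n : ℕ) (c : C₀) : D.Presented :=
  Ideal.Quotient.mkₐ k D.relIdeal (X (n, c))

variable {D}

theorem mk_eq_of_rel {f g : MvPolynomial (ℕ × C₀) k} (h : D.Rel (f - g)) :
    Ideal.Quotient.mkₐ k D.relIdeal f = Ideal.Quotient.mkₐ k D.relIdeal g :=
  Ideal.Quotient.eq.2 (Ideal.subset_span h)

theorem var_algebraMap (n : ℕ) (r : k) :
    D.var n (algebraMap k C₀ r) = algebraMap k D.Presented (σ^[n] r) :=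
  mk_eq_of_rel (.scalar n r)

variable (D) in
/-- The homomorphism `c ↦ σⁿ(c)` from `C₀` to the presented algebra. -/
noncomputable def varHom (n : ℕ) : C₀ →+* D.Presented where
  toFun := D.var n
  map_zero' := by simpa [iterate_map_zero] using var_algebraMap (D := D) n 0
  map_one' := by simpa [iterate_map_one] using var_algebraMap (D := D) n 1
  map_add' c d := (mk_eq_of_rel (.add n c d)).trans (map_add _ _ _)
  map_mul' c d := (mk_eq_of_rel (.mul n c d)).trans (map_mul _ _ _)

theorem presentedσ_varHom (n : ℕ) (c : C₀) :
    D.presentedσ (D.varHom n c) = D.varHom (n + 1) c := by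
  change Ideal.quotientMap _ _ _ (Ideal.Quotient.mk _ _) = Ideal.Quotient.mk _ _
  rw [Ideal.quotientMap_mk]
  simp [shift]

theorem varHom_s (n : ℕ) (a : A₀) : D.varHom n (D.s a) = D.varHom (n + 1) (D.p a) :=
  mk_eq_of_rel (.glue n a)

theorem adjoin_varHom :
    Algebra.adjoin k {x | ∃ n c, D.varHom n c = x} = ⊤ := by
  have h := congrArg (Subalgebra.map (Ideal.Quotient.mkₐ k D.relIdeal))
    (MvPolynomial.adjoin_range_X (R := k) (σ := ℕ × C₀))
  rw [AlgHom.map_adjoin, Algebra.map_top,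
    (AlgHom.range_eq_top _).2 (Ideal.Quotient.mkₐ_surjective k _), ← Set.range_comp] at h
  rw [← h]
  congr 1
  ext x
  exact ⟨fun ⟨n, c, h⟩ => ⟨(n, c), h⟩, fun ⟨y, h⟩ => ⟨y.1, y.2, h⟩⟩

/-- The universal property of the presented algebra, as a `k`-algebra. -/
theorem exists_lift {T : Type*} [CommRing T] [Algebra k T] (g : ℕ → C₀ →+* T)
    (hg : ∀ n r, g n (algebraMap k C₀ r) = algebraMap k T (σ^[n] r))
    (hglue : ∀ n a, g n (D.s a) = g (n + 1) (D.p a)) :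
    ∃ φ : D.Presented →ₐ[k] T, ∀ n c, φ (D.varHom n c) = g n c := by
  let ψ : MvPolynomial (ℕ × C₀) k →ₐ[k] T := aeval fun x => g x.1 x.2
  have hψ : D.relIdeal ≤ RingHom.ker ψ := by
    refine Ideal.span_le.2 ?_
    rintro f (⟨n, c, d⟩ | ⟨n, c, d⟩ | ⟨n, r⟩ | ⟨n, a⟩) <;>
      simp [ψ, RingHom.mem_ker, hg, hglue, ← MvPolynomial.algebraMap_eq]
  refine ⟨Ideal.Quotient.liftₐ D.relIdeal ψ fun a ha => hψ ha, fun n c => ?_⟩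
  change ψ (X (n, c)) = _
  simp [ψ]

/-- Homomorphisms on the part of the presented algebra up to time `m` and on the part from time
`m` on can be glued if they agree at time `m`. -/
theorem exists_glue {T : Type*} [CommRing T] [Algebra k T] (m : ℕ) (g₁ g₂ : D.Presented →ₐ[k] T)
    (h : ∀ c, g₁ (D.varHom m c) = g₂ (D.varHom m c)) :
    ∃ φ : D.Presented →ₐ[k] T, (∀ n ≤ m, ∀ c, φ (D.varHom n c) = g₁ (D.varHom n c)) ∧
      ∀ n, m ≤ n → ∀ c, φ (D.varHom n c) = g₂ (D.varHom n c) := by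
  have hs : ∀ (g : D.Presented →ₐ[k] T) n r,
      g (D.varHom n (algebraMap k C₀ r)) = algebraMap k T (σ^[n] r) := fun g n r =>
    (congrArg g (var_algebraMap n r)).trans (g.commutes _)
  obtain ⟨φ, hφ⟩ := exists_lift (D := D)
    (fun n => (if n ≤ m then g₁ else g₂ : D.Presented →ₐ[k] T).toRingHom.comp (D.varHom n))
    (fun n r => hs _ n r) (fun n a => by
      change (if n ≤ m then g₁ else g₂ : D.Presented →ₐ[k] T) (D.varHom n (D.s a)) =
        (if n + 1 ≤ m then g₁ else g₂ : D.Presented →ₐ[k] T) (D.varHom (n + 1) (D.p a))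
      rcases lt_trichotomy n m with hn | rfl | hn
      · rw [if_pos hn.le, if_pos (Nat.succ_le_of_lt hn), varHom_s]
      -- The only relation straddling the cut: time `m` falls under `g₁` and time `m + 1` under
      -- `g₂`, so agreement at time `m` is needed.
      · rw [if_pos le_rfl, if_neg (by omega), h, varHom_s]
      · rw [if_neg (by omega), if_neg (by omega), varHom_s])
  refine ⟨φ, fun n hn c => ?_, fun n hn c => ?_⟩
  · refine (hφ n c).trans ?_
    change (if n ≤ m then g₁ else g₂ : D.Presented →ₐ[k] T) (D.varHom n c) = _
    rw [if_pos hn]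
  · refine (hφ n c).trans ?_
    change (if n ≤ m then g₁ else g₂ : D.Presented →ₐ[k] T) (D.varHom n c) = _
    rcases hn.eq_or_lt with rfl | hn
    · rw [if_pos le_rfl, h]
    · rw [if_neg (by omega)]

end Cocorrespondence

end Presented

/-! ### Independence of past and future, and the dimension bound. -/

section Markov

variable {k : Type u} [Field k] {σ : k →+* k} {A : Type v} [CommRing A] [Algebra k A]
  {σA : A →+* A} {C₀ : Type w} [CommRing C₀]

/-- The subalgebra generated by the images of the maps `f n` with `n` in `S`. -/
def timeAdjoin (f : ℕ → C₀ →+* A) (S : Set ℕ) : Subalgebra k A :=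
  Algebra.adjoin k {x | ∃ n ∈ S, ∃ c, f n c = x}

theorem mem_timeAdjoin (f : ℕ → C₀ →+* A) {S : Set ℕ} {n : ℕ} (hn : n ∈ S) (c : C₀) :
    f n c ∈ timeAdjoin (k := k) f S :=
  Algebra.subset_adjoin ⟨n, hn, c, rfl⟩

theorem timeAdjoin_mono (f : ℕ → C₀ →+* A) {S T : Set ℕ} (h : S ⊆ T) :
    timeAdjoin (k := k) f S ≤ timeAdjoin f T :=
  Algebra.adjoin_mono fun _ ⟨n, hn, hc⟩ => ⟨n, h hn, hc⟩

theorem eqOn_timeAdjoin {T : Type*} [CommRing T] [Algebra k T] (f : ℕ → C₀ →+* A) {S : Set ℕ}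
    {φ ψ : A →ₐ[k] T} (h : ∀ n ∈ S, ∀ c, φ (f n c) = ψ (f n c)) {x : A}
    (hx : x ∈ timeAdjoin (k := k) f S) : φ x = ψ x := by
  have : timeAdjoin f S ≤ AlgHom.equalizer φ ψ :=
    Algebra.adjoin_le (by rintro _ ⟨n, hn, c, rfl⟩; exact h n hn c)
  exact this hx

theorem timeAdjoin_singleton (f : ℕ → C₀ →+* A) (m : ℕ) :
    timeAdjoin (k := k) f {m} = Algebra.adjoin k (Set.range (f m)) := by
  unfold timeAdjoin
  congr 1
  ext x
  simp

/-- If the maps `C₀ → A` are semilinear and `C₀` is finite-dimensional, then the image of each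
generates a subalgebra of dimension at most that of `C₀`. -/
theorem finrank_adjoin_range_le [Algebra k C₀] [Module.Finite k C₀] (τ : k →+* k) (f : C₀ →+* A)
    (hf : ∀ r, f (algebraMap k C₀ r) = algebraMap k A (τ r)) :
    Module.Finite k (Algebra.adjoin k (Set.range f)) ∧
      Module.finrank k (Algebra.adjoin k (Set.range f)) ≤ Module.finrank k C₀ := by
  let b := Module.finBasis k C₀
  have h : Subalgebra.toSubmodule (Algebra.adjoin k (Set.range f)) =
      Submodule.span k (Set.range (f ∘ b)) := by
    rw [Algebra.adjoin_eq_span]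
    -- The range is closed under multiplication, so the algebra it generates is merely its span.
    have : (Submonoid.closure (Set.range f) : Set A) = Set.range f := by
      rw [show Set.range f = (MonoidHom.mrange f.toMonoidHom : Set A) from rfl,
        Submonoid.closure_eq]
    rw [this]
    refine le_antisymm (Submodule.span_le.2 ?_)
      (Submodule.span_mono (Set.range_comp_subset_range _ _))
    rintro _ ⟨c, rfl⟩
    rw [← b.linearCombination_repr c, Finsupp.linearCombination_apply, Finsupp.sum, map_sum]
    refine sum_mem fun i _ => ?_
    rw [Algebra.smul_def, map_mul, hf, ← Algebra.smul_def]
    exact Submodule.smul_mem _ _ (Submodule.subset_span ⟨i, rfl⟩)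
  change Module.Finite k (Subalgebra.toSubmodule (Algebra.adjoin k (Set.range f))) ∧
    Module.finrank k (Subalgebra.toSubmodule (Algebra.adjoin k (Set.range f))) ≤ _
  rw [h]
  exact ⟨Module.Finite.span_of_finite k (Set.finite_range _),
    (finrank_range_le_card (f ∘ b)).trans (by simp)⟩

/-- Past and future meet in the present. -/
theorem timeAdjoin_inf_le [Algebra k C₀] [Algebra.Etale k C₀] (f : ℕ → C₀ →+* A) (m : ℕ) (τ : k →+* k)
    (hf : ∀ r, f m (algebraMap k C₀ r) = algebraMap k A (τ r))
    (hglue : ∀ (T : Type v) [CommRing T] [Algebra k T] (g₁ g₂ : A →ₐ[k] T),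
      (∀ c, g₁ (f m c) = g₂ (f m c)) →
        ∃ φ : A →ₐ[k] T, (∀ n ≤ m, ∀ c, φ (f n c) = g₁ (f n c)) ∧
          ∀ n, m ≤ n → ∀ c, φ (f n c) = g₂ (f n c)) :
    timeAdjoin (k := k) f (Set.Iic m) ⊓ timeAdjoin f (Set.Ici m) ≤ timeAdjoin f {m} := by
  rw [timeAdjoin_singleton]
  set D := Algebra.adjoin k (Set.range (f m)) with hD
  have : Module.Finite k C₀ := finite_of_etale
  have : Module.Finite k D := (finrank_adjoin_range_le τ (f m) hf).1
  have : Algebra.FormallyUnramified k D := formallyUnramified_adjoin_range τ (f m) hf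
  have : IsReduced D := Algebra.FormallyUnramified.isReduced_of_field k D
  have : IsArtinianRing D := IsArtinianRing.of_finite k D
  have : IsSemisimpleRing D := IsArtinianRing.isSemisimpleRing_of_isReduced D
  -- The two inclusions agree on `D`, so some `φ` is the left one on the past and the right one on
  -- the future. An `x` in both satisfies `x ⊗ 1 = 1 ⊗ x`.
  obtain ⟨φ, h₁, h₂⟩ := hglue (A ⊗[D] A)
    ((Algebra.TensorProduct.includeLeft : A →ₐ[D] A ⊗[D] A).restrictScalars k)
    ((Algebra.TensorProduct.includeRight : A →ₐ[D] A ⊗[D] A).restrictScalars k) (fun c => by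
      have := (Algebra.TensorProduct.includeLeft : A →ₐ[D] A ⊗[D] A).commutes
        ⟨f m c, Algebra.subset_adjoin ⟨c, rfl⟩⟩
      have h' := (Algebra.TensorProduct.includeRight : A →ₐ[D] A ⊗[D] A).commutes
        ⟨f m c, Algebra.subset_adjoin ⟨c, rfl⟩⟩
      exact this.trans h'.symm)
  rintro x ⟨hx₁, hx₂⟩
  exact mem_of_tmul_one_eq_one_tmul D
    ((eqOn_timeAdjoin f h₁ hx₁).symm.trans (eqOn_timeAdjoin f h₂ hx₂))

/-- A finitely generated submodule is compact, so it lies in one stage of the increasing union. -/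
theorem le_timeAdjoin_Iic_of_finite (f : ℕ → C₀ →+* A) (htop : timeAdjoin (k := k) f Set.univ = ⊤)
    (B : Subalgebra k A) [Module.Finite k B] : ∃ m, B ≤ timeAdjoin f (Set.Iic m) := by
  have hmono : Monotone fun m => timeAdjoin (k := k) f (Set.Iic m) := fun _ _ h =>
    timeAdjoin_mono f (Set.Iic_subset_Iic.2 h)
  have hsup : ⨆ m, Subalgebra.toSubmodule (timeAdjoin (k := k) f (Set.Iic m)) = ⊤ := by
    have : ⨆ m, timeAdjoin (k := k) f (Set.Iic m) = ⊤ := by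
      refine top_le_iff.1 (htop ▸ Algebra.adjoin_le ?_)
      rintro _ ⟨n, -, c, rfl⟩
      exact le_iSup (fun m => timeAdjoin (k := k) f (Set.Iic m)) n
        (mem_timeAdjoin f (Set.mem_Iic.2 le_rfl) c)
    refine Submodule.eq_top_iff'.2 fun x => ?_
    have hx : x ∈ ⨆ m, timeAdjoin (k := k) f (Set.Iic m) := this ▸ Algebra.mem_top
    rw [← SetLike.mem_coe, Subalgebra.coe_iSup_of_directed hmono.directed_le] at hx
    obtain ⟨m, hm⟩ := Set.mem_iUnion.1 hx
    exact Submodule.mem_iSup_of_mem m hm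
  have hfg : (Subalgebra.toSubmodule B).FG := Module.Finite.iff_fg.1 ‹_›
  obtain ⟨_, ⟨m, rfl⟩, hm⟩ := (Submodule.fg_iff_compact _).1 hfg
    (Set.range fun m => Subalgebra.toSubmodule (timeAdjoin (k := k) f (Set.Iic m))) ⊤
    (Set.range_nonempty _)
    (directedOn_range.2 (Monotone.directed_le (f := fun m =>
      Subalgebra.toSubmodule (timeAdjoin (k := k) f (Set.Iic m))) fun a b h => hmono h))
    (hsup ▸ isLUB_iSup) le_top
  exact ⟨m, hm⟩

/-- Each application of `σA` moves the generators one step later, and `B` lies in the span of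
`σ(B)`, so the containment can be improved indefinitely. -/
theorem le_timeAdjoin_Ici (hA : IsDiffAlgebra σ σA) (f : ℕ → C₀ →+* A)
    (hσ : ∀ n c, σA (f n c) = f (n + 1) c) (htop : timeAdjoin (k := k) f Set.univ = ⊤)
    {B : Subalgebra k A} (hB : Subalgebra.toSubmodule B ≤ Submodule.span k (σA '' B)) (m : ℕ) :
    B ≤ timeAdjoin f (Set.Ici m) := by
  induction m with
  | zero =>
    rw [show Set.Ici 0 = (Set.univ : Set ℕ) from Set.eq_univ_of_forall fun n => n.zero_le, htop]
    exact le_top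
  | succ m ih =>
    have hshift : ∀ x ∈ timeAdjoin (k := k) f (Set.Ici m),
        σA x ∈ timeAdjoin (k := k) f (Set.Ici (m + 1)) := by
      intro x hx
      induction hx using Algebra.adjoin_induction with
      | mem x hx =>
        obtain ⟨n, hn, c, rfl⟩ := hx
        rw [hσ]
        exact mem_timeAdjoin f (Nat.succ_le_succ hn) c
      | algebraMap r => exact hA r ▸ Subalgebra.algebraMap_mem _ _
      | add x y _ _ hx hy => exact map_add σA x y ▸ add_mem hx hy
      | mul x y _ _ hx hy => exact map_mul σA x y ▸ mul_mem hx hy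
    suffices h : Submodule.span k (σA '' B) ≤
        Subalgebra.toSubmodule (timeAdjoin (k := k) f (Set.Ici (m + 1))) from
      fun x hx => h (hB hx)
    refine Submodule.span_le.2 ?_
    rintro _ ⟨b, hb, rfl⟩
    exact hshift b (ih hb)

/-- The dimensions of the strongly σ-étale subalgebras of a finitely σ-presented étale difference
algebra are bounded. -/
theorem exists_finrank_le (hA : IsDiffAlgebra σ σA) (hfp : IsFinPresEtale.{u, v, w} σ σA) :
    ∃ N, ∀ B : Subalgebra k A, IsStronglyEtaleSubalgebra hA B → Module.finrank k B ≤ N := by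
  obtain ⟨A₀, C₀, _, _, _, _, D, -, hC, e, he⟩ := hfp
  have hfinC : Module.Finite k C₀ := finite_of_etale
  refine ⟨Module.finrank k C₀, fun B hB => ?_⟩
  obtain ⟨hfin, -, hs⟩ := (isStronglyEtaleSubalgebra_iff hA B).1 hB
  let f : ℕ → C₀ →+* A := fun n => e.symm.toRingEquiv.toRingHom.comp (D.varHom n)
  have hef : ∀ n c, e (f n c) = D.varHom n c := fun n c => e.apply_symm_apply _
  have hf : ∀ n r, f n (algebraMap k C₀ r) = algebraMap k A ((σ ^ n) r) := fun n r => by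
    refine e.injective ?_
    rw [hef, AlgEquiv.commutes, RingHom.coe_pow]
    exact Cocorrespondence.var_algebraMap n r
  have hσ : ∀ n c, σA (f n c) = f (n + 1) c := fun n c => by
    refine e.injective ?_
    rw [he, hef, hef, Cocorrespondence.presentedσ_varHom]
  have htop : timeAdjoin (k := k) f Set.univ = ⊤ := by
    have h := congrArg (Subalgebra.map e.symm.toAlgHom) (Cocorrespondence.adjoin_varHom (D := D))
    rw [AlgHom.map_adjoin, Algebra.map_top,
      (AlgHom.range_eq_top _).2 e.symm.surjective] at h
    refine top_le_iff.1 (h ▸ Algebra.adjoin_mono ?_)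
    rintro _ ⟨_, ⟨n, c, rfl⟩, rfl⟩
    exact ⟨n, trivial, c, rfl⟩
  obtain ⟨m, hm⟩ := le_timeAdjoin_Iic_of_finite f htop B
  have hle := (le_inf hm (le_timeAdjoin_Ici hA f hσ htop hs.ge m)).trans
    (timeAdjoin_inf_le f m (σ ^ m) (hf m) fun T _ _ g₁ g₂ h => by
      obtain ⟨φ, h₁, h₂⟩ := Cocorrespondence.exists_glue (D := D) m
        (g₁.comp e.symm.toAlgHom) (g₂.comp e.symm.toAlgHom) h
      refine ⟨φ.comp e.toAlgHom, fun n hn c => ?_, fun n hn c => ?_⟩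
      · exact (congrArg φ (hef n c)).trans (h₁ n hn c)
      · exact (congrArg φ (hef n c)).trans (h₂ n hn c))
  rw [timeAdjoin_singleton] at hle
  obtain ⟨hfinD, hD⟩ := finrank_adjoin_range_le (σ ^ m) (f m) (hf m)
  exact (Submodule.finrank_mono (s := Subalgebra.toSubmodule B)
    (t := Subalgebra.toSubmodule (Algebra.adjoin k (Set.range (f m)))) hle).trans hD

end Markov

end DiffAlg

theorem proposition5p8 {k : Type u} [Field k] (σ : k →+* k)
    {A : Type v} [CommRing A] [Algebra k A] (σA : A →+* A)
    (hA : DiffAlg.IsDiffAlgebra σ σA) (hfp : DiffAlg.IsFinPresEtale.{u, v, w} σ σA) :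
    ∃ B : Subalgebra k A,
      (B : Set A) = DiffAlg.strongCore hA ∧ DiffAlg.IsStronglyEtaleSubalgebra hA B := by
  obtain ⟨N, hN⟩ := DiffAlg.exists_finrank_le hA hfp
  obtain ⟨_, ⟨B, hB, rfl⟩, hmax⟩ := Set.exists_max_image
    ((fun B : Subalgebra k A => Module.finrank k B) '' {B | DiffAlg.IsStronglyEtaleSubalgebra hA B})
    id ((Set.finite_Iic N).subset (by rintro _ ⟨B, hB, rfl⟩; exact hN B hB))
    ⟨_, ⊥, DiffAlg.isStronglyEtaleSubalgebra_bot hA, rfl⟩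
  refine ⟨B, Set.Subset.antisymm
    (Set.subset_biUnion_of_mem (u := fun B : Subalgebra k A => (B : Set A)) hB)
    (Set.iUnion₂_subset fun B' hB' => ?_), hB⟩
  have hsup := DiffAlg.IsStronglyEtaleSubalgebra.sup (hA := hA) hB hB'
  have : Module.Finite k (B ⊔ B' : Subalgebra k A) :=
    ((DiffAlg.isStronglyEtaleSubalgebra_iff hA _).1 hsup).1
  -- By maximality the compositum with `B'` has no larger dimension than `B`, so nothing new is
  -- added.
  have heq : Subalgebra.toSubmodule B = Subalgebra.toSubmodule (B ⊔ B') :=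
    Submodule.eq_of_le_of_finrank_le (le_sup_left (a := B) (b := B'))
      (hmax _ ⟨_, hsup, rfl⟩)
  exact fun x hx => (heq.ge : _ ≤ Subalgebra.toSubmodule B)
    (le_sup_right (a := B) (b := B') hx : x ∈ B ⊔ B')
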